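/- Let $(\mathfrak H,[\cdot,\cdot])$ be a complex Krein space with fundamental symmetry $J$, i.e. $\mathfrak H$ is a complex Hilbert space with inner product $(\cdot,\cdot)$ (linear in the first argument) and norm $\|\cdot\|$, $J$ is a self-adjoint unitary operator on $\mathfrak H$, and $[f,g]=(Jf,g)$. A closed subspace is called positive (negative) if $[f,f]>0$ ($[f,f]<0$) for all its nonzero elements $f$, and maximal positive (maximal negative) if it is not properly contained in another positive (negative) subspace. For a sequence $\mathcal F=\{f_n\}_{n\in\mathbb N}$ in $\mathfrak H$ let $\mathbb N_+=\{n:[f_n,f_n]\ge 0\}$, $\mathbb N_-=\{n:[f_n,f_n]<0\}$, $\mathcal F_\pm=\{f_n\}_{n\in\mathbb N_\pm}$ and $\mathcal M_\pm=\overline{\mathrm{span}\,\mathcal F_\pm}$. The sequence $\mathcal F$ is called $J$-orthogonal if $[f_n,f_m]=0$ for $n\ne m$. It is called a $J$-frame if $\mathcal M_+$ is maximal positive, $\mathcal M_-$ is maximal negative, and there are constants $0<A\le B$ such that, for both signs, $$A\,|[f,f]|\le\sum_{n\in\mathbb N_\pm}|[f,f_n]|^2\le B\,|[f,f]|\qquad\text{for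 all } f\in\mathrm{span}\,\mathcal F_\pm .$$ Let $\mathcal F$ be a $J$-orthogonal Schauder basis of $\mathfrak H$ which is a $J$-frame. Then the sum $\mathcal M_+\dot+\mathcal M_-$ is direct. On it consider the energetic norm $\|f\|_{en}^2=\|f\|^2+[f_+,f_+]-[f_-,f_-]$, where $f=f_++f_-$, $f_\pm\in\mathcal M_\pm$. Let $\mathfrak D\subset\mathfrak H$ be the energetic linear manifold, i.e. the completion of $\mathcal M_+\dot+\mathcal M_-$ in the energetic norm, regarded as a set of elements of $\mathfrak H$ (the set of the limits in $\mathfrak H$ of the sequences in $\mathcal M_+\dot+\mathcal M_-$ that are Cauchy in the energetic norm). Let $\mathcal D_{un}$ be the set of all $f\in\mathfrak H$ for which the series $\sum_{n}\frac{[f,f_n]}{[f_n,f_n]}f_n$ converges unconditionally in $\mathfrak H$. Then $$\mathcal D_{un}\subseteq\mathcal M_+\dot+\mathcal M_-\subseteq\mathfrak D,$$ and both inclusions are strict whenever $\mathcal M_+\dot+\mathcal M_-\ne\mathfrak H$. Moreover, every $f\in\mathfrak H$ with $\{[f,f_n]\}\in l_1(\mathbb N)$ belongs to $\mathcal D_{un}$.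 -/

import Mathlib

open Filter Topology

namespace Krein

variable {H : Type*} [NormedAddCommGroup H] [InnerProductSpace ℂ H] [CompleteSpace H]

/-- `J` is a fundamental symmetry of the Hilbert space `H`: it is self-adjoint and unitary.
A complex Krein space with a fixed fundamental decomposition is the same thing as a complex Hilbert
space with such a `J`, the summands of the decomposition being `ker (J - 1)` and `ker (J + 1)`. -/
def IsFundamentalSymmetry (J : H →L[ℂ] H) : Prop :=
  IsSelfAdjoint J ∧ J ∈ unitary (H →L[ℂ] H)

/-- The indefinite inner product `[f, g] = (J f, g)`, linear in `f` and conjugate-linear in `g`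
(Mathlib's `inner ℂ x y` is linear in `y`). -/
noncomputable def form (J : H →L[ℂ] H) (f g : H) : ℂ := inner ℂ g (J f)

/-- The (real) number `[f, f]`. -/
noncomputable def quad (J : H →L[ℂ] H) (f : H) : ℝ := (form J f f).re

/-- A positive subspace: closed, and `[f, f] > 0` for all nonzero elements. -/
def IsPositive (J : H →L[ℂ] H) (L : Submodule ℂ H) : Prop :=
  IsClosed (L : Set H) ∧ ∀ f ∈ L, f ≠ 0 → 0 < quad J f

/-- A negative subspace: closed, and `[f, f] < 0` for all nonzero elements. -/
def IsNegative (J : H →L[ℂ] H) (L : Submodule ℂ H) : Prop :=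
  IsClosed (L : Set H) ∧ ∀ f ∈ L, f ≠ 0 → quad J f < 0

/-- The index set `ℕ₊`. -/
def posIdx (J : H →L[ℂ] H) (F : ℕ → H) : Set ℕ := {n | 0 ≤ quad J (F n)}

/-- The index set `ℕ₋`. -/
def negIdx (J : H →L[ℂ] H) (F : ℕ → H) : Set ℕ := {n | quad J (F n) < 0}

/-- `M₊`, the closed linear span of the `F n` with `n ∈ ℕ₊`. -/
def Mpos (J : H →L[ℂ] H) (F : ℕ → H) : Submodule ℂ H :=
  (Submodule.span ℂ (F '' posIdx J F)).topologicalClosure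

/-- `M₋`, the closed linear span of the `F n` with `n ∈ ℕ₋`. -/
def Mneg (J : H →L[ℂ] H) (F : ℕ → H) : Submodule ℂ H :=
  (Submodule.span ℂ (F '' negIdx J F)).topologicalClosure

/-- The two-sided estimate `A |[f, f]| ≤ ∑_{n ∈ I} |[f, F n]|² ≤ B |[f, f]|` for all `f` in the
linear span of `{F n : n ∈ I}` (the series being convergent). -/
def FrameBounds (J : H →L[ℂ] H) (F : ℕ → H) (I : Set ℕ) (A B : ℝ) : Prop :=
  ∀ f ∈ Submodule.span ℂ (F '' I),
    Summable (fun n : I => ‖form J f (F n)‖ ^ 2) ∧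
    A * |quad J f| ≤ ∑' n : I, ‖form J f (F n)‖ ^ 2 ∧
    ∑' n : I, ‖form J f (F n)‖ ^ 2 ≤ B * |quad J f|

/-- `F` is a `J`-frame: `M₊` is maximal positive, `M₋` is maximal negative, and the frame
inequalities hold on the spans of both halves with common bounds `0 < A ≤ B`. -/
def IsJFrame (J : H →L[ℂ] H) (F : ℕ → H) : Prop :=
  Maximal (IsPositive J) (Mpos J F) ∧ Maximal (IsNegative J) (Mneg J F) ∧
  ∃ A B : ℝ, 0 < A ∧ A ≤ B ∧
    FrameBounds J F (posIdx J F) A B ∧ FrameBounds J F (negIdx J F) A B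

/-- `F` is `J`-orthogonal: `[F n, F m] = 0` for `n ≠ m`. -/
def IsJOrthogonal (J : H →L[ℂ] H) (F : ℕ → H) : Prop :=
  ∀ n m, n ≠ m → form J (F n) (F m) = 0

/-- The square `‖p + m‖_en² = ‖p + m‖² + ‖p + m‖₁²` of the energetic norm of the element `p + m`,
`p ∈ M₊`, `m ∈ M₋`, of `M₊ ∔ M₋`. Here `‖p + m‖₁² = [p, p] - [m, m]` is the square of the norm given
by the positive inner product that the decomposition `M₊ ∔ M₋` generates. -/
noncomputable def energySq (J : H →L[ℂ] H) (p m : H) : ℝ :=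
  ‖p + m‖ ^ 2 + (quad J p - quad J m)

/-- The energetic linear manifold: the completion of `Mp ∔ Mm` in the energetic norm, as a set of
elements of `H`. The energetic norm dominates the norm of `H`, so that every sequence in `Mp ∔ Mm`
that is Cauchy for the energetic norm converges in `H`; the elements of the manifold are the limits
of these sequences. -/
def energeticManifold (J : H →L[ℂ] H) (Mp Mm : Submodule ℂ H) : Set H :=
  {f | ∃ p m : ℕ → H, (∀ k, p k ∈ Mp) ∧ (∀ k, m k ∈ Mm) ∧
    (∀ ε > 0, ∃ N, ∀ k ≥ N, ∀ l ≥ N, energySq J (p k - p l) (m k - m l) < ε) ∧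
    Tendsto (fun k => p k + m k) atTop (𝓝 f)}

/-- The set of all `f` in `H` whose expansion `∑ ([f, F n] / [F n, F n]) F n` converges
unconditionally in `H` (this is Mathlib's `Summable`). -/
def unconditionalSet (J : H →L[ℂ] H) (F : ℕ → H) : Set H :=
  {f | Summable (fun n => (form J f (F n) / form J (F n) (F n)) • F n)}

end Krein

/-! Write `c_n` for the coordinate functionals of the basis. J-orthogonality gives `[f, F n] =
c_n(f) [F n, F n]`, and the frame inequalities tested on `F n` give `A ≤ |[F n, F n]| ≤ B`. So the
expansion in the theorem is the basis expansion, and on each of `M₊`, `M₋` the sum of the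
`|c_n(f)|²` is at most `B / A² * |[f, f]|`. The `‖F n‖` are bounded as well (`norm_basis_sq_le`),
which yields the `l₁` criterion. The inclusions follow by splitting an unconditional series by sign
and by taking constant sequences.

Both strictness claims reduce to one criterion: if `‖p‖² ≤ C [p, p]` on `M₊`, then `M₊ ∔ M₋` is
everything (`sup_eq_top_of_norm_sq_le`).

If `M₊ ⊆ D_un`, uniform boundedness makes all finite coordinate projections on `M₊` uniformly
bounded. Hence changing signs of coefficients costs only a constant factor, while suitable signs
bring the squared norm below `∑ |c_n|² ‖F n‖²`, which is controlled by `[p, p]`.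

The energetic manifold contains all vectors with square summable coordinates. If it lies in `M₊ ∔
M₋`, these vectors form a Banach space split by two closed subspaces, so `‖p‖²` is bounded by a
multiple of the squared energetic norm of `p + m`. Maximality of `M₋` supplies an `m` for which that
is a multiple of `[p, p]`. -/

namespace Krein

/-! ### The indefinite form and maximal negative subspaces. -/

section Form

variable {H : Type*} [NormedAddCommGroup H] [InnerProductSpace ℂ H] {J : H →L[ℂ] H}

/-- `form J · g` as a continuous linear functional. -/
noncomputable def formL (J : H →L[ℂ] H) (g : H) : H →L[ℂ] ℂ := (innerSL ℂ g).comp J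

@[simp] theorem formL_apply (f g : H) : formL J g f = form J f g := rfl

theorem form_add_left (f g h : H) : form J (f + g) h = form J f h + form J g h :=
  map_add (formL J h) f g

theorem form_smul_left (a : ℂ) (f g : H) : form J (a • f) g = a * form J f g :=
  map_smul (formL J g) a f

theorem form_add_right (f g h : H) : form J f (g + h) = form J f g + form J f h :=
  inner_add_left _ _ _

theorem form_smul_right (a : ℂ) (f g : H) :
    form J f (a • g) = (starRingEnd ℂ) a * form J f g := inner_smul_left _ _ _

@[simp] theorem quad_zero : quad J 0 = 0 := by simp [quad, form]

theorem quad_neg (f : H) : quad J (-f) = quad J f := by simp [quad, form]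

theorem quad_smul (a : ℂ) (f : H) : quad J (a • f) = ‖a‖ ^ 2 * quad J f := by
  rw [quad, form_smul_left, form_smul_right, ← mul_assoc, Complex.mul_conj,
    Complex.normSq_eq_norm_sq, Complex.re_ofReal_mul, quad]

theorem continuous_quad : Continuous (quad J) :=
  Complex.continuous_re.comp (continuous_id.inner J.continuous)

theorem quad_of_apply_eq {f : H} (h : J f = f) : quad J f = ‖f‖ ^ 2 := by
  rw [quad, form, h]
  exact inner_self_eq_norm_sq (𝕜 := ℂ) f

theorem quad_of_apply_eq_neg {f : H} (h : J f = -f) : quad J f = -‖f‖ ^ 2 := by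
  rw [quad, form, h, inner_neg_right, Complex.neg_re]
  exact congrArg _ (inner_self_eq_norm_sq (𝕜 := ℂ) f)

theorem eq_zero_of_mem_closure_span {E : Type*} [NormedAddCommGroup E] [NormedSpace ℂ E]
    {S : Set H} (T : H →L[ℂ] E) (hT : ∀ x ∈ S, T x = 0) {x : H}
    (hx : x ∈ (Submodule.span ℂ S).topologicalClosure) : T x = 0 := by
  have h : (Submodule.span ℂ S).topologicalClosure ≤ T.ker :=
    Submodule.topologicalClosure_minimal _ (Submodule.span_le.2 hT) T.isClosed_ker
  exact h hx

variable [CompleteSpace H]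

theorem IsFundamentalSymmetry.inner_apply (hJ : IsFundamentalSymmetry J) (f g : H) :
    inner ℂ (J f) g = inner ℂ f (J g) := hJ.1.isSymmetric f g

theorem IsFundamentalSymmetry.norm_apply (hJ : IsFundamentalSymmetry J) (f : H) :
    ‖J f‖ = ‖f‖ := ContinuousLinearMap.norm_map_of_mem_unitary hJ.2 f

theorem IsFundamentalSymmetry.apply_apply (hJ : IsFundamentalSymmetry J) (f : H) :
    J (J f) = f := by
  have h := Unitary.star_mul_self_of_mem hJ.2
  rw [hJ.1.star_eq] at h
  exact DFunLike.congr_fun h f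

theorem IsFundamentalSymmetry.conj_form (hJ : IsFundamentalSymmetry J) (f g : H) :
    (starRingEnd ℂ) (form J f g) = form J g f := by
  rw [form, inner_conj_symm, hJ.inner_apply, form]

theorem IsFundamentalSymmetry.form_self (hJ : IsFundamentalSymmetry J) (f : H) :
    form J f f = (quad J f : ℂ) :=
  (Complex.conj_eq_iff_re.1 (hJ.conj_form f f)).symm

theorem IsFundamentalSymmetry.norm_form_self (hJ : IsFundamentalSymmetry J) (f : H) :
    ‖form J f f‖ = |quad J f| := by
  rw [hJ.form_self, Complex.norm_real, Real.norm_eq_abs]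

theorem IsFundamentalSymmetry.norm_form_le (hJ : IsFundamentalSymmetry J) (f g : H) :
    ‖form J f g‖ ≤ ‖f‖ * ‖g‖ := by
  rw [mul_comm, ← hJ.norm_apply f]
  exact norm_inner_le_norm _ _

theorem IsFundamentalSymmetry.quad_add (hJ : IsFundamentalSymmetry J) {f g : H}
    (h : form J f g = 0) : quad J (f + g) = quad J f + quad J g := by
  have h' : form J g f = 0 := by rw [← hJ.conj_form, h, map_zero]
  simp [quad, form_add_left, form_add_right, h, h']

theorem IsFundamentalSymmetry.quad_sum (hJ : IsFundamentalSymmetry J) {ι : Type*} {v : ι → H}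
    (hv : ∀ i j, i ≠ j → form J (v i) (v j) = 0) (s : Finset ι) (a : ι → ℂ) :
    quad J (∑ i ∈ s, a i • v i) = ∑ i ∈ s, ‖a i‖ ^ 2 * quad J (v i) := by
  classical
  induction s using Finset.induction_on with
  | empty => simp
  | insert i s hi ih =>
    rw [Finset.sum_insert hi, Finset.sum_insert hi, add_comm, hJ.quad_add, ih, quad_smul, add_comm]
    rw [← formL_apply, map_sum]
    refine Finset.sum_eq_zero fun j hj => ?_
    rw [formL_apply, form_smul_left, form_smul_right, hv j i (by rintro rfl; exact hi hj)]
    simp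

theorem IsFundamentalSymmetry.norm_sub_apply_sq (hJ : IsFundamentalSymmetry J) (f : H) :
    ‖f - J f‖ ^ 2 = 2 * ‖f‖ ^ 2 - 2 * quad J f := by
  rw [norm_sub_sq (𝕜 := ℂ), hJ.norm_apply, quad, form]
  simp only [RCLike.re_eq_complex_re]
  ring

/-- The projection of a maximal negative subspace to `ker (J + 1)` is onto. -/
theorem exists_sub_apply_eq_of_maximal_isNegative (hJ : IsFundamentalSymmetry J)
    {M : Submodule ℂ H} (hM : Maximal (IsNegative J) M) {y : H} (hy : J y = -y) :
    ∃ m ∈ M, m - J m = y := by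
  set T : H →L[ℂ] H := ContinuousLinearMap.id ℂ H - J with hT
  have hTx (x : H) : T x = x - J x := rfl
  have hclosed : IsClosed (M : Set H) := hM.prop.1
  have hquad : ∀ m ∈ M, quad J m ≤ 0 := fun m hm => by
    rcases eq_or_ne m 0 with rfl | h
    · simp
    · exact (hM.prop.2 m hm h).le
  have := hclosed.completeSpace_coe
  -- On `M` one has `‖m - J m‖² = 2‖m‖² - 2[m, m] ≥ ‖m‖²`, so `T` is bounded below there and its
  -- image `K` is closed.
  have hanti : AntilipschitzWith 1 (T.comp M.subtypeL) := by
    refine AddMonoidHomClass.antilipschitz_of_bound _ fun m => ?_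
    have h1 := hJ.norm_sub_apply_sq (m : H)
    have h2 := hquad m m.2
    have h3 : ‖(m : H)‖ ^ 2 ≤ ‖(m : H) - J m‖ ^ 2 := by nlinarith [sq_nonneg ‖(m : H)‖]
    simpa [hTx] using le_of_sq_le_sq h3 (norm_nonneg _)
  set K : Submodule ℂ H := (T.comp M.subtypeL).range with hK
  have hKc : IsClosed (K : Set H) := by
    rw [hK, LinearMap.coe_range]
    exact hanti.isClosed_range (T.comp M.subtypeL).uniformContinuous
  have hmemK {x : H} : x ∈ K ↔ ∃ m ∈ M, m - J m = x := by
    simp [hK, LinearMap.mem_range, hTx]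
  have := hKc.completeSpace_coe
  have hJK : ∀ x ∈ K, J x = -x := fun x hx => by
    obtain ⟨m, -, rfl⟩ := hmemK.1 hx
    rw [map_sub, hJ.apply_apply, neg_sub]
  -- A nonzero `h` would be a negative vector J-orthogonal to `M`. Then `M ⊔ ℂ ∙ h` is still
  -- negative, so maximality puts `h` in `M` and makes `h` J-orthogonal to itself.
  set h : H := y - K.starProjection y with hh
  have hperp : h ∈ Kᗮ := K.sub_starProjection_mem_orthogonal y
  have hJh : J h = -h := by
    rw [hh, map_sub, hy, hJK _ (K.starProjection_apply_mem y)]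
    abel
  have hform : ∀ m ∈ M, form J m h = 0 := fun m hm => by
    have h1 : inner ℂ h (m - J m) = 0 :=
      (Submodule.mem_orthogonal' _ _).1 hperp _ (hmemK.2 ⟨m, hm, rfl⟩)
    have h2 : inner ℂ h (J m) = -inner ℂ h m := by
      rw [← hJ.inner_apply, hJh, inner_neg_left]
    rw [inner_sub_right, h2] at h1
    rw [form, h2]
    linear_combination (-1 / 2 : ℂ) * h1
  suffices h0 : h = 0 by
    have hyK : y = K.starProjection y := sub_eq_zero.1 h0
    exact hmemK.1 (hyK ▸ K.starProjection_apply_mem y)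
  by_contra hne
  have hneg : IsNegative J (M ⊔ ℂ ∙ h) := by
    refine ⟨Submodule.isClosed_sup_finiteDimensional _ _ hclosed, fun f hf hf0 => ?_⟩
    obtain ⟨m, hm, x, hx, rfl⟩ := Submodule.mem_sup.1 hf
    obtain ⟨a, rfl⟩ := Submodule.mem_span_singleton.1 hx
    rw [hJ.quad_add (by rw [form_smul_right, hform m hm, mul_zero]), quad_smul,
      quad_of_apply_eq_neg hJh]
    have hpos : 0 < ‖h‖ ^ 2 := by positivity
    rcases eq_or_ne m 0 with rfl | hm0
    · have ha : a ≠ 0 := by rintro rfl; simp at hf0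
      have : 0 < ‖a‖ ^ 2 := by positivity
      rw [quad_zero]
      nlinarith [mul_pos this hpos]
    · have := hM.prop.2 m hm hm0
      nlinarith [mul_nonneg (sq_nonneg ‖a‖) hpos.le]
  have hhM : h ∈ M := hM.le_of_ge hneg le_sup_left
    (Submodule.mem_sup_right (Submodule.mem_span_singleton_self h))
  have h1 : quad J h = 0 := by rw [quad, hform h hhM, Complex.zero_re]
  exact (hM.prop.2 h hhM hne).ne h1

end Form

/-- Some choice of signs makes the norm of a sum at most the `ℓ²` sum of the norms. -/
theorem exists_signs_norm_sum_sq_le {H : Type*} [NormedAddCommGroup H] [InnerProductSpace ℂ H]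
    {ι : Type*} (s : Finset ι) (v : ι → H) :
    ∃ t ⊆ s, ∃ u ⊆ s, Disjoint t u ∧ (∀ i ∈ s, i ∈ t ∨ i ∈ u) ∧
      ‖∑ i ∈ t, v i - ∑ i ∈ u, v i‖ ^ 2 ≤ ∑ i ∈ s, ‖v i‖ ^ 2 := by
  classical
  induction s using Finset.induction_on with
  | empty => exact ⟨∅, by simp, ∅, by simp, by simp⟩
  | insert j s hj ih =>
    obtain ⟨t, ht, u, hu, hd, hc, hle⟩ := ih
    have hjt : j ∉ t := fun h => hj (ht h)
    have hju : j ∉ u := fun h => hj (hu h)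
    set x := ∑ i ∈ t, v i - ∑ i ∈ u, v i
    -- The smaller of the two squares is at most their mean, `‖x‖² + ‖v j‖²`; this decides the sign
    -- of `v j`.
    have hpar : ‖x + v j‖ ^ 2 + ‖x - v j‖ ^ 2 = 2 * (‖x‖ ^ 2 + ‖v j‖ ^ 2) := by
      have := parallelogram_law_with_norm ℂ x (v j)
      nlinarith
    rw [Finset.sum_insert hj]
    rcases le_total (‖x + v j‖ ^ 2) (‖x - v j‖ ^ 2) with h | h
    · refine ⟨insert j t, Finset.insert_subset_insert _ ht, u,
        hu.trans (Finset.subset_insert _ _), Finset.disjoint_insert_left.2 ⟨hju, hd⟩, ?_, ?_⟩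
      · simp only [Finset.mem_insert]
        rintro i (rfl | hi)
        · simp
        · rcases hc i hi with h | h <;> simp [h]
      · rw [Finset.sum_insert hjt, show v j + ∑ i ∈ t, v i - ∑ i ∈ u, v i = x + v j by
          simp only [x]; abel]
        linarith
    · refine ⟨t, ht.trans (Finset.subset_insert _ _), insert j u,
        Finset.insert_subset_insert _ hu, Finset.disjoint_insert_right.2 ⟨hjt, hd⟩, ?_, ?_⟩
      · simp only [Finset.mem_insert]
        rintro i (rfl | hi)
        · simp
        · rcases hc i hi with h | h <;> simp [h]
      · rw [Finset.sum_insert hju, show ∑ i ∈ t, v i - (v j + ∑ i ∈ u, v i) = x - v j by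
          simp only [x]; abel]
        linarith

/-! ### J-orthogonal Schauder bases and coordinate estimates. -/

section Basis

variable {H : Type*} [NormedAddCommGroup H] [InnerProductSpace ℂ H]
  {J : H →L[ℂ] H} (F : SchauderBasis ℂ H)

theorem mem_closure_span_range (f : H) :
    f ∈ (Submodule.span ℂ (Set.range F)).topologicalClosure := by
  refine mem_closure_of_tendsto (SchauderBasis.tendsto_proj F f) (.of_forall fun n => ?_)
  rw [SchauderBasis.proj_apply]
  exact Submodule.sum_mem _ fun i _ => Submodule.smul_mem _ _ (Submodule.subset_span ⟨i, rfl⟩)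

@[simp] theorem coord_self (n : ℕ) : F.coord n (F n) = 1 := by simp [F.ortho]

theorem coord_of_ne {n m : ℕ} (h : n ≠ m) : F.coord n (F m) = 0 := by
  simp [F.ortho, h]

theorem basis_ne_zero (n : ℕ) : F n ≠ 0 := fun h => by
  have := coord_self F n
  simp [h] at this

theorem coord_eq_zero_of_notMem {I : Set ℕ} {f : H}
    (hf : f ∈ (Submodule.span ℂ (F '' I)).topologicalClosure) {n : ℕ} (hn : n ∉ I) :
    F.coord n f = 0 := by
  refine eq_zero_of_mem_closure_span (F.coord n) ?_ hf
  rintro _ ⟨i, hi, rfl⟩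
  exact coord_of_ne F (by rintro rfl; exact hn hi)

open Classical in
/-- The `k`-th partial sum of the expansion of `f`, restricted to the indices in `I`. -/
noncomputable def partialSum (I : Set ℕ) (f : H) (k : ℕ) : H :=
  ∑ i ∈ Finset.range k, (if i ∈ I then F.coord i f else 0) • F i

theorem partialSum_mem_span (I : Set ℕ) (f : H) (k : ℕ) :
    partialSum F I f k ∈ Submodule.span ℂ (F '' I) := by
  refine Submodule.sum_mem _ fun i _ => ?_
  split_ifs with h
  · exact Submodule.smul_mem _ _ (Submodule.subset_span ⟨i, h, rfl⟩)
  · simp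

theorem partialSum_mem (I : Set ℕ) (f : H) (k : ℕ) :
    partialSum F I f k ∈ (Submodule.span ℂ (F '' I)).topologicalClosure :=
  Submodule.le_topologicalClosure _ (partialSum_mem_span F I f k)

theorem partialSum_add_partialSum_compl (I : Set ℕ) (f : H) (k : ℕ) :
    partialSum F I f k + partialSum F Iᶜ f k = SchauderBasis.proj F k f := by
  rw [SchauderBasis.proj_apply, partialSum, partialSum, ← Finset.sum_add_distrib]
  refine Finset.sum_congr rfl fun i _ => ?_
  by_cases h : i ∈ I <;> simp [h]

theorem coord_proj (f : H) (i l : ℕ) :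
    F.coord i (SchauderBasis.proj F l f) = if i < l then F.coord i f else 0 := by
  rw [SchauderBasis.proj_apply, map_sum]
  simp [F.ortho, Pi.single_apply]

theorem partialSum_sub {I : Set ℕ} (f : H) {k l : ℕ} (h : l ≤ k) :
    partialSum F I f k - partialSum F I f l = partialSum F I (f - SchauderBasis.proj F l f) k := by
  classical
  simp only [partialSum]
  rw [← Finset.sum_range_add_sum_Ico _ h, ← Finset.sum_range_add_sum_Ico _ h]
  rw [add_sub_cancel_left, Finset.sum_eq_zero (s := Finset.range l), zero_add]
  · refine Finset.sum_congr rfl fun i hi => ?_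
    rw [map_sub, coord_proj, if_neg (Finset.mem_Ico.1 hi).1.not_gt, sub_zero]
  · intro i hi
    rw [map_sub, coord_proj, if_pos (Finset.mem_range.1 hi), sub_self, ite_self, zero_smul]

section

variable {F} (hF : IsJOrthogonal J F)
include hF

/-- Both sides are continuous linear functionals of `f` that agree on the basis vectors. -/
theorem form_eq_coord_mul (f : H) (n : ℕ) :
    form J f (F n) = F.coord n f * form J (F n) (F n) := by
  have h := eq_zero_of_mem_closure_span (formL J (F n) - form J (F n) (F n) • F.coord n)
    (S := Set.range F) ?_ (mem_closure_span_range F f)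
  · simpa [sub_eq_zero, mul_comm] using h
  · rintro _ ⟨m, rfl⟩
    rcases eq_or_ne n m with rfl | h
    · simp
    · simp [coord_of_ne F h, hF m n h.symm]

theorem form_eq_zero_of_disjoint {I I' : Set ℕ} (hI : Disjoint I I') {f g : H}
    (hf : f ∈ (Submodule.span ℂ (F '' I)).topologicalClosure)
    (hg : g ∈ (Submodule.span ℂ (F '' I')).topologicalClosure) : form J f g = 0 := by
  have h1 : ∀ n ∈ I', form J f (F n) = 0 := fun n hn => by
    rw [form_eq_coord_mul hF, coord_eq_zero_of_notMem F hf (Set.disjoint_right.1 hI hn), zero_mul]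
  have h2 := eq_zero_of_mem_closure_span (innerSL ℂ (J f)) (S := F '' I') (by
    rintro _ ⟨n, hn, rfl⟩
    rw [innerSL_apply_apply, ← inner_conj_symm]
    exact (congrArg _ (h1 n hn)).trans (map_zero _)) hg
  rw [innerSL_apply_apply] at h2
  rw [form, ← inner_conj_symm, h2, map_zero]

end

variable [CompleteSpace H]

theorem exists_norm_coord_mul_norm_le : ∃ K : ℝ, 0 ≤ K ∧
    ∀ n f, ‖F.coord n f‖ * ‖F n‖ ≤ K * ‖f‖ := by
  obtain ⟨K, hK⟩ := SchauderBasis.exists_norm_proj_le F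
  have hK0 : 0 ≤ K := (norm_nonneg _).trans (hK 0)
  refine ⟨K + K, by positivity, fun n f => ?_⟩
  have h : F.coord n f • F n = SchauderBasis.proj F (n + 1) f - SchauderBasis.proj F n f := by
    simp [Finset.sum_range_succ]
  rw [← norm_smul, h, add_mul]
  exact (norm_sub_le _ _).trans (add_le_add ((SchauderBasis.proj F _).le_of_opNorm_le (hK _) f)
    ((SchauderBasis.proj F _).le_of_opNorm_le (hK _) f))

variable {F} (hJ : IsFundamentalSymmetry J) (hF : IsJOrthogonal J F)
include hJ hF

/-- A neutral `F n` would be J-orthogonal to every vector, in particular to `J (F n)`, forcing `‖F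
n‖² = 0`. -/
theorem quad_basis_ne_zero (n : ℕ) : quad J (F n) ≠ 0 := fun h => by
  have h1 : form J (J (F n)) (F n) = 0 := by
    rw [form_eq_coord_mul hF, hJ.form_self, h, Complex.ofReal_zero, mul_zero]
  rw [form, hJ.apply_apply] at h1
  exact basis_ne_zero F n (inner_self_eq_zero.1 h1)

theorem form_basis_ne_zero (n : ℕ) : form J (F n) (F n) ≠ 0 := by
  rw [hJ.form_self]
  exact_mod_cast quad_basis_ne_zero hJ hF n

theorem form_div_form (f : H) (n : ℕ) :
    form J f (F n) / form J (F n) (F n) = F.coord n f := by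
  rw [form_eq_coord_mul hF, mul_div_assoc, div_self (form_basis_ne_zero hJ hF n), mul_one]

theorem mem_unconditionalSet_iff (f : H) :
    f ∈ unconditionalSet J F ↔ Summable fun n => F.coord n f • F n := by
  simp only [unconditionalSet, Set.mem_ofPred_eq, form_div_form hJ hF]

/-- For `f = F n` the frame sum has the single term `[F n, F n]²`; divide by `|[F n, F n]|`. -/
theorem FrameBounds.abs_quad_basis_mem {I : Set ℕ} {A B : ℝ} (h : FrameBounds J F I A B)
    {n : ℕ} (hn : n ∈ I) : A ≤ |quad J (F n)| ∧ |quad J (F n)| ≤ B := by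
  obtain ⟨-, h1, h2⟩ := h (F n) (Submodule.subset_span ⟨n, hn, rfl⟩)
  rw [tsum_eq_single ⟨n, hn⟩ fun m hm => by
    rw [hF n m fun h => hm (Subtype.ext h.symm)]; simp, hJ.norm_form_self] at h1 h2
  have := abs_pos.2 (quad_basis_ne_zero hJ hF n)
  rw [sq] at h1 h2
  exact ⟨le_of_mul_le_mul_right h1 this, le_of_mul_le_mul_right h2 this⟩

/-- On the span, `A² ∑ |c_n|² ≤ ∑ |[f, F n]|² ≤ B |[f, f]|`. For a finite set of indices both sides
are continuous in `f`, so the bound passes to the closure. -/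
theorem FrameBounds.sum_norm_coord_sq_le {I : Set ℕ} {A B : ℝ} (h : FrameBounds J F I A B)
    (hA : 0 < A) {f : H} (hf : f ∈ (Submodule.span ℂ (F '' I)).topologicalClosure)
    (s : Finset ℕ) : ∑ n ∈ s, ‖F.coord n f‖ ^ 2 ≤ B / A ^ 2 * |quad J f| := by
  classical
  have hcl : IsClosed {f : H | ∑ n ∈ s, ‖F.coord n f‖ ^ 2 ≤ B / A ^ 2 * |quad J f|} :=
    isClosed_le (by fun_prop) (continuous_const.mul continuous_quad.abs)
  refine closure_minimal (fun f hf => ?_) hcl hf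
  obtain ⟨hs, -, h2⟩ := h f hf
  have hf' := Submodule.le_topologicalClosure _ hf
  rw [Set.mem_ofPred_eq, div_mul_eq_mul_div, le_div_iff₀ (by positivity)]
  refine le_trans ?_ h2
  have hind : ∑' n : I, ‖form J f (F n)‖ ^ 2 =
      ∑' n, I.indicator (fun n => ‖form J f (F n)‖ ^ 2) n :=
    tsum_subtype I (fun n => ‖form J f (F n)‖ ^ 2)
  have hs' : Summable (I.indicator fun n => ‖form J f (F n)‖ ^ 2) :=
    summable_subtype_iff_indicator.1 hs
  rw [hind, Finset.sum_mul]
  refine (Finset.sum_le_sum fun n _ => ?_).trans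
    (hs'.sum_le_tsum s fun n _ => Set.indicator_nonneg (fun _ _ => by positivity) n)
  by_cases hn : n ∈ I
  · rw [Set.indicator_of_mem hn, form_eq_coord_mul hF, norm_mul, mul_pow, hJ.norm_form_self]
    gcongr
    exact (h.abs_quad_basis_mem hJ hF hn).1
  · rw [Set.indicator_of_notMem hn, coord_eq_zero_of_notMem F hf' hn]
    simp

/-- The `n`-th coordinate of `J (F n)` is `‖F n‖² / [F n, F n]`, and `hK` bounds its modulus by `K`
because `J` is isometric. -/
theorem norm_basis_sq_le {K b : ℝ} (hK : ∀ n f, ‖F.coord n f‖ * ‖F n‖ ≤ K * ‖f‖) (hK0 : 0 ≤ K)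
    {n : ℕ} (hb : |quad J (F n)| ≤ b) : ‖F n‖ ^ 2 ≤ K * b := by
  have h1 := hK n (J (F n))
  have hpos : 0 < ‖F n‖ := norm_pos_iff.2 (basis_ne_zero F n)
  rw [hJ.norm_apply] at h1
  have h2 : ‖F.coord n (J (F n))‖ ≤ K := le_of_mul_le_mul_right h1 hpos
  have h3 : form J (J (F n)) (F n) = F.coord n (J (F n)) * form J (F n) (F n) :=
    form_eq_coord_mul hF _ n
  have h4 := congrArg norm h3
  rw [form, hJ.apply_apply, norm_mul, hJ.norm_form_self, inner_self_eq_norm_sq_to_K, norm_pow,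
    RCLike.norm_ofReal, abs_norm] at h4
  rw [h4]
  gcongr

theorem quad_partialSum (I : Set ℕ) (f : H) (k : ℕ) [DecidablePred (· ∈ I)] :
    quad J (partialSum F I f k) =
      ∑ i ∈ Finset.range k, if i ∈ I then ‖F.coord i f‖ ^ 2 * quad J (F i) else 0 := by
  rw [partialSum, hJ.quad_sum hF]
  refine Finset.sum_congr rfl fun i _ => ?_
  split_ifs <;> simp

end Basis

/-! ### The sum `M₊ ∔ M₋`, the energetic manifold and unconditional convergence. -/

section Frame

variable {H : Type*} [NormedAddCommGroup H] [InnerProductSpace ℂ H]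
  {J : H →L[ℂ] H} {F : SchauderBasis ℂ H}

theorem compl_posIdx (J : H →L[ℂ] H) (F : ℕ → H) : (posIdx J F)ᶜ = negIdx J F := by
  ext n
  simp [posIdx, negIdx]

theorem disjoint_posIdx_negIdx (J : H →L[ℂ] H) (F : ℕ → H) :
    Disjoint (posIdx J F) (negIdx J F) :=
  compl_posIdx J F ▸ disjoint_compl_right

theorem disjoint_of_isPositive_of_isNegative {M N : Submodule ℂ H} (hM : IsPositive J M)
    (hN : IsNegative J N) : Disjoint M N := by
  refine Submodule.disjoint_def.2 fun f hf hf' => ?_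
  by_contra h
  exact (hM.2 f hf h).not_gt (hN.2 f hf' h)

theorem IsPositive.quad_nonneg {M : Submodule ℂ H} (hM : IsPositive J M) {f : H} (hf : f ∈ M) :
    0 ≤ quad J f := by
  rcases eq_or_ne f 0 with rfl | h
  · simp
  · exact (hM.2 f hf h).le

theorem IsNegative.quad_nonpos {M : Submodule ℂ H} (hM : IsNegative J M) {f : H} (hf : f ∈ M) :
    quad J f ≤ 0 := by
  rcases eq_or_ne f 0 with rfl | h
  · simp
  · exact (hM.2 f hf h).le

theorem sup_subset_energeticManifold (J : H →L[ℂ] H) (Mp Mm : Submodule ℂ H) :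
    ((Mp ⊔ Mm : Submodule ℂ H) : Set H) ⊆ energeticManifold J Mp Mm := by
  intro f hf
  obtain ⟨p, hp, m, hm, rfl⟩ := Submodule.mem_sup.1 hf
  exact ⟨fun _ => p, fun _ => m, fun _ => hp, fun _ => hm,
    fun ε hε => ⟨0, fun _ _ _ _ => by simpa [energySq] using hε⟩, tendsto_const_nhds⟩

theorem form_Mpos_Mneg (hF : IsJOrthogonal J F) {p m : H} (hp : p ∈ Mpos J F)
    (hm : m ∈ Mneg J F) : form J p m = 0 :=
  form_eq_zero_of_disjoint hF (disjoint_posIdx_negIdx J F) hp hm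

theorem partialSum_pos_add_partialSum_neg (J : H →L[ℂ] H) (F : SchauderBasis ℂ H) (f : H)
    (k : ℕ) : partialSum F (posIdx J F) f k + partialSum F (negIdx J F) f k =
      SchauderBasis.proj F k f := by
  rw [← compl_posIdx, partialSum_add_partialSum_compl]

/-- A tail estimate for the `ℓ²` sums of coordinates. -/
theorem sum_norm_coord_sub_proj_sq (F : SchauderBasis ℂ H) (f : H) {k l : ℕ} (h : l ≤ k) :
    ∑ i ∈ Finset.range k, ‖F.coord i (f - SchauderBasis.proj F l f)‖ ^ 2 =
      ∑ i ∈ Finset.range k, ‖F.coord i f‖ ^ 2 - ∑ i ∈ Finset.range l, ‖F.coord i f‖ ^ 2 := by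
  rw [← Finset.sum_range_add_sum_Ico _ h, ← Finset.sum_range_add_sum_Ico _ h, add_sub_cancel_left,
    Finset.sum_eq_zero (s := Finset.range l), zero_add]
  · refine Finset.sum_congr rfl fun i hi => ?_
    rw [map_sub, coord_proj, if_neg (Finset.mem_Ico.1 hi).1.not_gt, sub_zero]
  · intro i hi
    rw [map_sub, coord_proj, if_pos (Finset.mem_range.1 hi), sub_self]
    simp

variable [CompleteSpace H]

theorem mem_unconditionalSet_of_summable (hJ : IsFundamentalSymmetry J) {A D : ℝ} (hA : 0 < A)
    (hq : ∀ n, A ≤ |quad J (F n)|) (hD : ∀ n, ‖F n‖ ≤ D) {f : H}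
    (hf : Summable fun n => ‖form J f (F n)‖) : f ∈ unconditionalSet J F := by
  refine Summable.of_norm_bounded (hf.mul_right (D / A)) fun n => ?_
  rw [norm_smul, norm_div, hJ.norm_form_self, div_mul_eq_mul_div, mul_div_assoc]
  have h0 := (norm_nonneg _).trans (hD n)
  gcongr
  · exact hD n
  · exact hq n

/-- If vectors with square summable coordinates lie in `M₊ ∔ M₋`, then the projection to `M₊` is
bounded for the energetic norm. -/
theorem exists_norm_sq_le_energySq {c : ℝ} (hc0 : 0 ≤ c) (hpos : IsPositive J (Mpos J F))
    (hneg : IsNegative J (Mneg J F))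
    (hc : ∀ p ∈ Mpos J F, ∀ m ∈ Mneg J F, ∀ s : Finset ℕ,
      ∑ n ∈ s, ‖F.coord n (p + m)‖ ^ 2 ≤ c * (quad J p - quad J m))
    (hsub : ∀ f, (Summable fun n => ‖F.coord n f‖ ^ 2) → f ∈ Mpos J F ⊔ Mneg J F) :
    ∃ C, 0 ≤ C ∧ ∀ p ∈ Mpos J F, ∀ m ∈ Mneg J F, ‖p‖ ^ 2 ≤ C * energySq J p m := by
  let E := lp (fun _ : ℕ => ℂ) 2
  -- `G` is the space of vectors with square summable coordinates, realised as the closed graph of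
  -- the coordinate map in `H × ℓ²`, hence complete.
  let G : Submodule ℂ (H × E) := ⨅ n, ((F.coord n).comp (ContinuousLinearMap.fst ℂ H E) -
    (lp.evalCLM ℂ (fun _ : ℕ => ℂ) 2 n).comp (ContinuousLinearMap.snd ℂ H E)).ker
  have hGmem (x : H × E) : x ∈ G ↔ ∀ n, F.coord n x.1 = x.2 n := by
    simp only [G, Submodule.mem_iInf, LinearMap.mem_ker]
    exact forall_congr' fun n => sub_eq_zero
  have hGc : IsClosed (G : Set (H × E)) := by
    rw [Submodule.coe_iInf]
    exact isClosed_iInter fun n => ContinuousLinearMap.isClosed_ker _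
  have := hGc.completeSpace_coe
  have hlift : ∀ p ∈ Mpos J F, ∀ m ∈ Mneg J F, ∃ x : G, (x : H × E).1 = p + m ∧
      ‖x‖ ^ 2 ≤ (1 + c) * energySq J p m := fun p hp m hm => by
    have hq : 0 ≤ quad J p - quad J m :=
      sub_nonneg.2 ((hneg.quad_nonpos hm).trans (hpos.quad_nonneg hp))
    have hle (s : Finset ℕ) : ∑ n ∈ s, ‖F.coord n (p + m)‖ ^ (2 : ENNReal).toReal ≤
        √(c * (quad J p - quad J m)) ^ (2 : ENNReal).toReal := by
      simpa [Real.sq_sqrt (mul_nonneg hc0 hq)] using hc p hp m hm s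
    let y : E := ⟨fun n => F.coord n (p + m), memℓp_gen' hle⟩
    have hy : ‖y‖ ≤ √(c * (quad J p - quad J m)) :=
      lp.norm_le_of_forall_sum_le (by simp) (Real.sqrt_nonneg _) hle
    have hy2 : ‖y‖ ^ 2 ≤ c * (quad J p - quad J m) := by
      rw [← Real.sq_sqrt (mul_nonneg hc0 hq)]
      gcongr
    refine ⟨⟨(p + m, y), (hGmem _).2 fun n => rfl⟩, rfl, ?_⟩
    rw [Submodule.coe_norm, Prod.norm_def, energySq]
    rcases max_choice ‖p + m‖ ‖y‖ with h | h <;> simp only [h] <;>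
      nlinarith [sq_nonneg ‖p + m‖, mul_nonneg hc0 (sq_nonneg ‖p + m‖), mul_nonneg hc0 hq]
  let π : G →L[ℂ] H := (ContinuousLinearMap.fst ℂ H E).comp G.subtypeL
  have hπ0 (x : G) (h : π x = 0) : x = 0 := by
    have h1 : (x : H × E).1 = 0 := h
    have h2 : (x : H × E).2 = 0 := by
      ext n
      rw [← (hGmem _).1 x.2 n, h1, map_zero]
      rfl
    exact Subtype.ext (Prod.ext h1 h2)
  let P : Submodule ℂ G := (Mpos J F).comap (π : G →ₗ[ℂ] H)
  let Q : Submodule ℂ G := (Mneg J F).comap (π : G →ₗ[ℂ] H)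
  have hPc : IsClosed (P : Set G) := hpos.1.preimage π.continuous
  have hQc : IsClosed (Q : Set G) := hneg.1.preimage π.continuous
  -- By `hsub` each element of `G` splits in `M₊ ∔ M₋`; `hlift` brings the `M₊` part back into `G`.
  -- Closed complements in a Banach space have bounded projections.
  have hPQ : IsCompl P Q := by
    refine ⟨Submodule.disjoint_def.2 fun x hx hx' => hπ0 x ?_, codisjoint_iff.2 ?_⟩
    · exact Submodule.disjoint_def.1 (disjoint_of_isPositive_of_isNegative hpos hneg) _ hx hx'
    · refine eq_top_iff.2 fun x _ => ?_
      have hx : π x ∈ Mpos J F ⊔ Mneg J F := by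
        refine hsub _ ?_
        have h2 := (lp.memℓp (x : H × E).2).summable (by simp)
        simp only [← (hGmem _).1 x.2] at h2
        exact (by simpa using h2 : Summable fun n => ‖F.coord n (x : H × E).1‖ ^ 2)
      obtain ⟨p, hp, m, hm, hpm⟩ := Submodule.mem_sup.1 hx
      obtain ⟨y, hy, -⟩ := hlift p hp 0 (zero_mem _)
      have hyp : π y = p := by rw [← add_zero p, ← hy]; rfl
      have hyP : y ∈ P := show π y ∈ Mpos J F from hyp ▸ hp
      have hxyQ : x - y ∈ Q := by
        change π (x - y) ∈ Mneg J F
        rw [map_sub, hyp, ← hpm, add_sub_cancel_left]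
        exact hm
      simpa using Submodule.add_mem_sup hyP hxyQ
  have htop := Submodule.IsCompl.isTopCompl_of_isClosed hPQ hPc hQc
  let R : G →L[ℂ] H := π.comp (P.subtypeL.comp (P.projectionOntoL Q htop))
  refine ⟨‖R‖ ^ 2 * (1 + c), by positivity, fun p hp m hm => ?_⟩
  obtain ⟨x, hx, hxn⟩ := hlift p hp m hm
  obtain ⟨y, hy, -⟩ := hlift p hp 0 (zero_mem _)
  have hyp : π y = p := by rw [← add_zero p, ← hy]; rfl
  have hyP : y ∈ P := show π y ∈ Mpos J F from hyp ▸ hp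
  have hxyQ : x - y ∈ Q := by
    change π (x - y) ∈ Mneg J F
    rw [map_sub, hyp, show π x = p + m from hx, add_sub_cancel_left]
    exact hm
  have hR : R x = p := by
    have h1 : P.projectionOntoL Q htop x = ⟨y, hyP⟩ := by
      rw [← add_sub_cancel y x, map_add,
        Submodule.projectionOntoL_apply_eq_zero_of_mem_right htop hxyQ, add_zero]
      exact Submodule.projectionOntoL_apply_left htop ⟨y, hyP⟩
    simp only [R, ContinuousLinearMap.comp_apply, h1]
    exact hyp
  calc ‖p‖ ^ 2 = ‖R x‖ ^ 2 := by rw [hR]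
    _ ≤ (‖R‖ * ‖x‖) ^ 2 := by gcongr; exact R.le_opNorm x
    _ = ‖R‖ ^ 2 * ‖x‖ ^ 2 := by ring
    _ ≤ ‖R‖ ^ 2 * ((1 + c) * energySq J p m) := by gcongr
    _ = _ := by ring

variable (hJ : IsFundamentalSymmetry J) (hF : IsJOrthogonal J F)
include hJ hF

/-- If `M₊` is uniformly positive, then `M₊ ∔ M₋` is the whole space. -/
theorem sup_eq_top_of_norm_sq_le {C : ℝ} (hC : ∀ p ∈ Mpos J F, ‖p‖ ^ 2 ≤ C * quad J p) :
    Mpos J F ⊔ Mneg J F = ⊤ := by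
  refine eq_top_iff.2 fun f _ => ?_
  set p := partialSum F (posIdx J F) f
  set m := partialSum F (negIdx J F) f
  have hp : ∀ k, p k ∈ Mpos J F := partialSum_mem F _ f
  have hm : ∀ k, m k ∈ Mneg J F := partialSum_mem F _ f
  have hpm : Tendsto (fun k => p k + m k) atTop (𝓝 f) := by
    simpa only [p, m, partialSum_pos_add_partialSum_neg] using SchauderBasis.tendsto_proj F f
  -- J-orthogonality gives `[x, x] = [x + y, x] ≤ ‖x + y‖ ‖x‖`. Thus the `M₊` part of a Cauchy
  -- sequence of sums is itself Cauchy.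
  have key : ∀ x ∈ Mpos J F, ∀ y ∈ Mneg J F, ‖x‖ ≤ |C| * ‖x + y‖ := fun x hx y hy => by
    have h1 : form J x x = form J (x + y) x := by
      rw [form_add_left, ← hJ.conj_form x y, form_Mpos_Mneg hF hx hy, map_zero, add_zero]
    have h2 : |quad J x| ≤ ‖x + y‖ * ‖x‖ := by
      rw [← hJ.norm_form_self, h1]
      exact hJ.norm_form_le _ _
    have h3 : ‖x‖ ^ 2 ≤ |C| * (‖x + y‖ * ‖x‖) := (hC x hx).trans <| (le_abs_self _).trans <| by
      rw [abs_mul]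
      gcongr
    rcases eq_or_ne x 0 with rfl | hx0
    · simp only [norm_zero]; positivity
    · refine le_of_mul_le_mul_right ?_ (norm_pos_iff.2 hx0)
      nlinarith
  have hpc : CauchySeq p := by
    rw [Metric.cauchySeq_iff]
    intro ε hε
    obtain ⟨N, hN⟩ := Metric.cauchySeq_iff.1 hpm.cauchySeq (ε / (|C| + 1)) (by positivity)
    refine ⟨N, fun k hk l hl => ?_⟩
    have h1 := hN k hk l hl
    rw [dist_eq_norm, lt_div_iff₀ (by positivity)] at h1
    have h2 := key _ (sub_mem (hp k) (hp l)) _ (sub_mem (hm k) (hm l))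
    rw [sub_add_sub_comm] at h2
    rw [dist_eq_norm]
    nlinarith [norm_nonneg (p k + m k - (p l + m l))]
  obtain ⟨x, hx⟩ := cauchySeq_tendsto_of_complete hpc
  have hx' : x ∈ Mpos J F :=
    (Submodule.isClosed_topologicalClosure _).mem_of_tendsto hx (.of_forall hp)
  have hy : f - x ∈ Mneg J F :=
    (Submodule.isClosed_topologicalClosure _).mem_of_tendsto
      (by simpa using hpm.sub hx) (.of_forall hm)
  simpa using Submodule.add_mem_sup hx' hy

theorem quad_partialSum_sub_le {B : ℝ} (hB : ∀ n, |quad J (F n)| ≤ B) (f : H) (k : ℕ) :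
    quad J (partialSum F (posIdx J F) f k) - quad J (partialSum F (negIdx J F) f k) ≤
      B * ∑ i ∈ Finset.range k, ‖F.coord i f‖ ^ 2 := by
  classical
  rw [quad_partialSum hJ hF, quad_partialSum hJ hF, ← Finset.sum_sub_distrib, Finset.mul_sum]
  refine Finset.sum_le_sum fun i _ => ?_
  have h1 := abs_le.1 (hB i)
  have h2 := sq_nonneg ‖F.coord i f‖
  by_cases hi : i ∈ posIdx J F
  · have hi' : i ∉ negIdx J F := Set.disjoint_left.1 (disjoint_posIdx_negIdx J F) hi
    rw [if_pos hi, if_neg hi']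
    nlinarith
  · have hi' : i ∈ negIdx J F := compl_posIdx J F ▸ hi
    rw [if_neg hi, if_pos hi']
    nlinarith

/-- Vectors with square summable coordinates belong to the energetic manifold. -/
theorem mem_energeticManifold_of_summable {B : ℝ} (hB : ∀ n, |quad J (F n)| ≤ B) {f : H}
    (hf : Summable fun n => ‖F.coord n f‖ ^ 2) :
    f ∈ energeticManifold J (Mpos J F) (Mneg J F) := by
  set p := partialSum F (posIdx J F) f with hp
  set m := partialSum F (negIdx J F) f with hm
  have hpm (k : ℕ) : p k + m k = SchauderBasis.proj F k f :=
    partialSum_pos_add_partialSum_neg J F f k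
  have hlim : Tendsto (fun k => p k + m k) atTop (𝓝 f) := by
    simpa only [hpm] using SchauderBasis.tendsto_proj F f
  refine ⟨p, m, partialSum_mem F _ f, partialSum_mem F _ f, fun ε hε => ?_, hlim⟩
  have hB0 : 0 ≤ B := (abs_nonneg _).trans (hB 0)
  set S : ℕ → ℝ := fun k => ∑ i ∈ Finset.range k, ‖F.coord i f‖ ^ 2 with hS
  have hSc : CauchySeq S := hf.hasSum.tendsto_sum_nat.cauchySeq
  -- The differences are partial sums for the tail `f - proj l f`, so the form part is at most `B`
  -- times a block of `∑ |c_i(f)|²`.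
  have key : ∀ k l, l ≤ k → energySq J (p k - p l) (m k - m l) ≤
      dist (p k + m k) (p l + m l) ^ 2 + B * dist (S k) (S l) := fun k l h => by
    rw [energySq, sub_add_sub_comm, dist_eq_norm, hp, hm, partialSum_sub F f h,
      partialSum_sub F f h]
    refine add_le_add le_rfl ((quad_partialSum_sub_le hJ hF hB _ k).trans ?_)
    rw [sum_norm_coord_sub_proj_sq F f h]
    exact mul_le_mul_of_nonneg_left (le_abs_self _) hB0
  have hsymm : ∀ k l, energySq J (p k - p l) (m k - m l) =
      energySq J (p l - p k) (m l - m k) := fun k l => by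
    rw [← neg_sub (p l), ← neg_sub (m l), energySq, quad_neg, quad_neg, ← neg_add, norm_neg,
      energySq]
  obtain ⟨N₁, hN₁⟩ := Metric.cauchySeq_iff.1 hlim.cauchySeq (√(ε / 2)) (by positivity)
  obtain ⟨N₂, hN₂⟩ := Metric.cauchySeq_iff.1 hSc (ε / (2 * (B + 1))) (by positivity)
  have main : ∀ k ≥ max N₁ N₂, ∀ l ≥ max N₁ N₂, l ≤ k →
      energySq J (p k - p l) (m k - m l) < ε := fun k hk l hl h => by
    have h1 := hN₁ k (le_of_max_le_left hk) l (le_of_max_le_left hl)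
    have h2 := hN₂ k (le_of_max_le_right hk) l (le_of_max_le_right hl)
    rw [Real.lt_sqrt dist_nonneg] at h1
    rw [lt_div_iff₀ (by positivity)] at h2
    have h3 : 0 ≤ dist (S k) (S l) := dist_nonneg
    have := key k l h
    nlinarith
  refine ⟨max N₁ N₂, fun k hk l hl => ?_⟩
  rcases le_total l k with h | h
  · exact main k hk l hl h
  · rw [hsymm]
    exact main l hl k hk h

theorem unconditionalSet_subset_sup :
    unconditionalSet J F ⊆ ((Mpos J F ⊔ Mneg J F : Submodule ℂ H) : Set H) := by
  intro f hf
  rw [mem_unconditionalSet_iff hJ hF] at hf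
  have hsum : ∑' n, F.coord n f • F n = f :=
    tendsto_nhds_unique hf.hasSum.tendsto_sum_nat
      (by simpa using SchauderBasis.tendsto_proj F f)
  have hmem (I : Set ℕ) : ∑' n, I.indicator (fun n => F.coord n f • F n) n ∈
      (Submodule.span ℂ (F '' I)).topologicalClosure := by
    refine (Submodule.isClosed_topologicalClosure _).mem_of_tendsto (hf.indicator I).hasSum
      (.of_forall fun s => Submodule.le_topologicalClosure _ (Submodule.sum_mem _ fun n _ => ?_))
    by_cases hn : n ∈ I
    · rw [Set.indicator_of_mem hn]
      exact Submodule.smul_mem _ _ (Submodule.subset_span ⟨n, hn, rfl⟩)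
    · simp [hn]
  rw [← hsum, ← tsum_congr fun n =>
    congrFun (Set.indicator_self_add_compl (posIdx J F) fun n => F.coord n f • F n) n]
  refine (Summable.tsum_add (hf.indicator _) (hf.indicator _)).symm ▸ ?_
  refine Submodule.add_mem_sup (hmem _) ?_
  rw [compl_posIdx]
  exact hmem _

/-- If the expansions of all elements of `M₊` converge unconditionally, then `M₊` is uniformly
positive. -/
theorem exists_norm_sq_le_of_Mpos_subset (hpos : IsPositive J (Mpos J F)) {c D : ℝ}
    (hD : ∀ n, ‖F n‖ ^ 2 ≤ D)
    (hc : ∀ p ∈ Mpos J F, ∀ s : Finset ℕ, ∑ n ∈ s, ‖F.coord n p‖ ^ 2 ≤ c * quad J p)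
    (hsub : (Mpos J F : Set H) ⊆ unconditionalSet J F) :
    ∃ C, ∀ p ∈ Mpos J F, ‖p‖ ^ 2 ≤ C * quad J p := by
  classical
  have hcomp : CompleteSpace (Mpos J F) := hpos.1.completeSpace_coe
  -- Pointwise boundedness comes from the Cauchy criterion: outside a finite set `A` every finite
  -- partial sum has norm below `1`.
  obtain ⟨K, hK⟩ : ∃ K, ∀ s : Finset ℕ,
      ‖(GeneralSchauderBasis.proj F s).comp (Mpos J F).subtypeL‖ ≤ K := by
    refine banach_steinhaus fun p => ?_
    have hs := (mem_unconditionalSet_iff hJ hF _).1 (hsub p.2)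
    obtain ⟨A, hA⟩ := summable_iff_vanishing_norm.1 hs 1 one_pos
    refine ⟨∑ n ∈ A, ‖F.coord n p • F n‖ + 1, fun s => ?_⟩
    rw [ContinuousLinearMap.comp_apply, GeneralSchauderBasis.proj_apply,
      ← Finset.sum_inter_add_sum_sdiff s A]
    refine (norm_add_le _ _).trans (add_le_add ((norm_sum_le _ _).trans ?_)
      (hA _ Finset.sdiff_disjoint).le)
    exact Finset.sum_le_sum_of_subset_of_nonneg Finset.inter_subset_right
      fun _ _ _ => norm_nonneg _
  have hproj : ∀ x ∈ Mpos J F, ∀ s, ‖∑ n ∈ s, F.coord n x • F n‖ ≤ K * ‖x‖ := fun x hx s => by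
    simpa using ContinuousLinearMap.le_of_opNorm_le _ (hK s) (⟨x, hx⟩ : Mpos J F)
  have hK0 : 0 ≤ K := (norm_nonneg ((GeneralSchauderBasis.proj F ∅).comp (Mpos J F).subtypeL)).trans (hK ∅)
  have hD0 : 0 ≤ D := (sq_nonneg _).trans (hD 0)
  refine ⟨4 * K ^ 2 * D * c, fun p hp => ?_⟩
  refine le_of_tendsto ((SchauderBasis.tendsto_proj F p).norm.pow 2) (.of_forall fun k => ?_)
  have hmem (n : ℕ) : F.coord n p • F n ∈ Mpos J F := by
    by_cases hn : n ∈ posIdx J F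
    · exact Submodule.smul_mem _ _
        (Submodule.le_topologicalClosure _ (Submodule.subset_span ⟨n, hn, rfl⟩))
    · rw [coord_eq_zero_of_notMem F hp hn, zero_smul]
      exact zero_mem _
  obtain ⟨t, ht, u, hu, htu, hcov, hle⟩ :=
    exists_signs_norm_sum_sq_le (Finset.range k) fun n => F.coord n p • F n
  set g := ∑ n ∈ t, F.coord n p • F n - ∑ n ∈ u, F.coord n p • F n with hg
  have hgM : g ∈ Mpos J F :=
    sub_mem (Submodule.sum_mem _ fun n _ => hmem n) (Submodule.sum_mem _ fun n _ => hmem n)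
  have hcg (n : ℕ) : F.coord n g =
      (if n ∈ t then F.coord n p else 0) - if n ∈ u then F.coord n p else 0 := by
    simp [hg, F.ortho, Pi.single_apply]
  -- Undoing the signs of `g` takes one projection onto `t` and one onto `u`, whence the factor `2 *
  -- K`.
  have hsplit : SchauderBasis.proj F k p =
      ∑ n ∈ t, F.coord n g • F n - ∑ n ∈ u, F.coord n g • F n := by
    have hrange : Finset.range k = t ∪ u := by
      ext n
      rw [Finset.mem_union]
      exact ⟨hcov n, fun h => h.elim (@ht n) (@hu n)⟩
    rw [SchauderBasis.proj_apply, hrange, Finset.sum_union htu, sub_eq_add_neg,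
      ← Finset.sum_neg_distrib]
    congr 1
    · refine Finset.sum_congr rfl fun n hn => ?_
      rw [hcg, if_pos hn, if_neg (Finset.disjoint_left.1 htu hn), sub_zero]
    · refine Finset.sum_congr rfl fun n hn => ?_
      rw [hcg, if_pos hn, if_neg (Finset.disjoint_right.1 htu hn), zero_sub, neg_smul, neg_neg]
  have h1 : ‖SchauderBasis.proj F k p‖ ≤ 2 * K * ‖g‖ := by
    rw [hsplit]
    refine (norm_sub_le _ _).trans ((add_le_add (hproj g hgM t) (hproj g hgM u)).trans_eq ?_)
    ring
  have h2 : ‖g‖ ^ 2 ≤ D * (c * quad J p) := by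
    refine hle.trans ?_
    calc ∑ n ∈ Finset.range k, ‖F.coord n p • F n‖ ^ 2
        ≤ ∑ n ∈ Finset.range k, D * ‖F.coord n p‖ ^ 2 := Finset.sum_le_sum fun n _ => by
          rw [norm_smul, mul_pow, mul_comm]
          gcongr
          exact hD n
      _ ≤ _ := by
          rw [← Finset.mul_sum]
          gcongr
          exact hc p hp _
  calc ‖SchauderBasis.proj F k p‖ ^ 2 ≤ (2 * K * ‖g‖) ^ 2 := by gcongr
    _ = 4 * K ^ 2 * ‖g‖ ^ 2 := by ring
    _ ≤ 4 * K ^ 2 * (D * (c * quad J p)) := by gcongr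
    _ = _ := by ring

/-- Every element of `M₊` can be shifted by an element of `M₋` so that the energetic norm of the
result is controlled by the form. -/
theorem exists_energySq_le (hneg : Maximal (IsNegative J) (Mneg J F)) {p : H}
    (hp : p ∈ Mpos J F) : ∃ m ∈ Mneg J F, energySq J p m ≤ 3 * quad J p := by
  -- The choice `m - J m = J p - p` puts `p + m` in `ker (J - 1)`. Then `‖p + m‖² = [p, p] + [m,
  -- m]`, so the energy is exactly `2 [p, p]`; the constant `3` is slack.
  obtain ⟨m, hm, hmp⟩ := exists_sub_apply_eq_of_maximal_isNegative hJ hneg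
    (y := J p - p) (by rw [map_sub, hJ.apply_apply, neg_sub])
  refine ⟨m, hm, ?_⟩
  have h1 : J (p + m) = p + m := by
    rw [map_add, ← sub_eq_zero]
    rw [← sub_eq_zero] at hmp
    rw [← neg_eq_zero, ← hmp]
    abel
  have h2 := hJ.quad_add (form_Mpos_Mneg hF hp hm)
  rw [quad_of_apply_eq h1] at h2
  have h3 := hneg.prop.quad_nonpos hm
  rw [energySq]
  nlinarith [sq_nonneg ‖p + m‖]

end Frame

end Krein

theorem theorem4p8 {H : Type*} [NormedAddCommGroup H] [InnerProductSpace ℂ H] [CompleteSpace H]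
    (J : H →L[ℂ] H) (hJ : Krein.IsFundamentalSymmetry J)
    (F : SchauderBasis ℂ H) (hF : Krein.IsJOrthogonal J F) (hframe : Krein.IsJFrame J F) :
    Disjoint (Krein.Mpos J F) (Krein.Mneg J F) ∧
    Krein.unconditionalSet J F ⊆ ((Krein.Mpos J F ⊔ Krein.Mneg J F : Submodule ℂ H) : Set H) ∧
    ((Krein.Mpos J F ⊔ Krein.Mneg J F : Submodule ℂ H) : Set H) ⊆
      Krein.energeticManifold J (Krein.Mpos J F) (Krein.Mneg J F) ∧
    (Krein.Mpos J F ⊔ Krein.Mneg J F ≠ ⊤ →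
      Krein.unconditionalSet J F ⊂ ((Krein.Mpos J F ⊔ Krein.Mneg J F : Submodule ℂ H) : Set H) ∧
      ((Krein.Mpos J F ⊔ Krein.Mneg J F : Submodule ℂ H) : Set H) ⊂
        Krein.energeticManifold J (Krein.Mpos J F) (Krein.Mneg J F)) ∧
    ∀ f : H, Summable (fun n => ‖Krein.form J f (F n)‖) → f ∈ Krein.unconditionalSet J F := by
  open Krein in
  obtain ⟨hpos, hneg, A, B, hA, hAB, hfp, hfn⟩ := hframe
  have hB : 0 < B := hA.trans_le hAB
  have hq (n : ℕ) : A ≤ |quad J (F n)| ∧ |quad J (F n)| ≤ B := by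
    by_cases hn : n ∈ posIdx J F
    · exact hfp.abs_quad_basis_mem hJ hF hn
    · exact hfn.abs_quad_basis_mem hJ hF (compl_posIdx J F ▸ hn : n ∈ negIdx J F)
  obtain ⟨K, hK0, hK⟩ := exists_norm_coord_mul_norm_le F
  have hD (n : ℕ) : ‖F n‖ ^ 2 ≤ K * B := norm_basis_sq_le hJ hF hK hK0 (hq n).2
  have hcp : ∀ p ∈ Mpos J F, ∀ s : Finset ℕ,
      ∑ n ∈ s, ‖F.coord n p‖ ^ 2 ≤ B / A ^ 2 * quad J p := fun p hp s => by
    simpa only [abs_of_nonneg (hpos.prop.quad_nonneg hp)] using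
      hfp.sum_norm_coord_sq_le hJ hF hA hp s
  have hcm : ∀ m ∈ Mneg J F, ∀ s : Finset ℕ,
      ∑ n ∈ s, ‖F.coord n m‖ ^ 2 ≤ B / A ^ 2 * -quad J m := fun m hm s => by
    simpa only [abs_of_nonpos (hneg.prop.quad_nonpos hm)] using
      hfn.sum_norm_coord_sq_le hJ hF hA hm s
  have hc : ∀ p ∈ Mpos J F, ∀ m ∈ Mneg J F, ∀ s : Finset ℕ,
      ∑ n ∈ s, ‖F.coord n (p + m)‖ ^ 2 ≤ B / A ^ 2 * (quad J p - quad J m) :=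
    fun p hp m hm s => by
      rw [sub_eq_add_neg, mul_add]
      refine le_trans (Finset.sum_le_sum fun n _ => ?_)
        (Finset.sum_add_distrib.trans_le (add_le_add (hcp p hp s) (hcm m hm s)))
      by_cases hn : n ∈ posIdx J F
      · rw [map_add, coord_eq_zero_of_notMem F hm
          (Set.disjoint_left.1 (disjoint_posIdx_negIdx J F) hn)]
        simp
      · rw [map_add, coord_eq_zero_of_notMem F hp hn]
        simp
  have hun := unconditionalSet_subset_sup hJ hF
  have hen := sup_subset_energeticManifold J (Mpos J F) (Mneg J F)
  refine ⟨disjoint_of_isPositive_of_isNegative hpos.prop hneg.prop, hun, hen,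
    fun hne => ⟨⟨hun, fun h => hne ?_⟩, ⟨hen, fun h => hne ?_⟩⟩, fun f hf => ?_⟩
  -- In both cases equality of the two sets makes `M₊` uniformly positive, contradicting `hne`.
  · obtain ⟨C, hC⟩ := exists_norm_sq_le_of_Mpos_subset hJ hF hpos.prop hD hcp
      fun p hp => h (Submodule.mem_sup_left hp)
    exact sup_eq_top_of_norm_sq_le hJ hF hC
  · obtain ⟨C, hC0, hC⟩ := exists_norm_sq_le_energySq (by positivity) hpos.prop hneg.prop hc
      fun f hf => h (mem_energeticManifold_of_summable hJ hF (fun n => (hq n).2) hf)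
    refine sup_eq_top_of_norm_sq_le hJ hF (C := C * 3) fun p hp => ?_
    obtain ⟨m, hm, hle⟩ := exists_energySq_le hJ hF hneg hp
    calc ‖p‖ ^ 2 ≤ C * energySq J p m := hC p hp m hm
      _ ≤ C * (3 * quad J p) := by gcongr
      _ = C * 3 * quad J p := by ring
  · exact mem_unconditionalSet_of_summable hJ hA (fun n => (hq n).1)
      (fun n => Real.le_sqrt_of_sq_le (hD n)) hf
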